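/- For integers $r,n\ge 0$ let $$d_r(n)=\det\left(\binom{2i+2j+r}{i+j}\right)_{i,j=0}^{n-1},$$ with the convention $d_r(0)=1$. Then for all integers $n\ge 0$ the following hold. 1. For all integers $k\ge 0$: $d_{2k+1}((2k+1)n)=(2n+1)^k$. 2. For all integers $k\ge 0$: $d_{2k+1}((2k+1)n+k+1)=(-1)^{\binom{k+1}{2}}\,4^k\,(n+1)^k$. 3. For all integers $k\ge 0$: $d_{2k}(2kn)=(-1)^{kn}$. 4. For all integers $k\ge 1$: $d_{2k}(2kn+k)=(-1)^{kn+\binom{k}{2}}\,(4k)^{k-1}\,(n+1)^{k-1}$. -/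

import Mathlib

/-- The order-`n` Hankel determinant `d_r(n)` of the sequence `m ↦ binom (2m + r) m`, that is, the
determinant of the matrix with entries `binom (2i + 2j + r) (i + j)` for `0 ≤ i, j ≤ n - 1`
(so `d_r(0) = 1`). -/
def hankelDet (r n : ℕ) : ℤ :=
  Matrix.det (Matrix.of fun i j : Fin n =>
    (Nat.choose (2 * (i : ℕ) + 2 * (j : ℕ) + r) ((i : ℕ) + (j : ℕ)) : ℤ))

/-! Let `Λ` send `X ^ m` to `binom (2m + 1) m`. The polynomials `chebP n` are monic and orthonormal
for `Λ`, and `binom (2m + r) m = Λ (A * X ^ e * X ^ m)`, where `A = chebP k`, `e = k` if `r = 2k +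
1`, and `A = chebT k`, `e = k - 1` if `r = 2k > 0`. So `d_r(N)` is a Hankel determinant of `Λ`
modified by `Q = A * X ^ e`, and Christoffel's formula (`det_hankel_mul`) turns it into a
determinant of fixed size `deg Q`: the coefficients of `chebP (N + j)` modulo `Q`, up to sign.

This small determinant splits along `Q = A * X ^ e`. Modulo `A` the sequence `chebP` is
antiperiodic, since `w ^ r = -1` at the roots of `A`; for the given `N` the first `deg A` remainders
are, up to a common sign, `chebP 0, chebP 1, ...` in direct or reversed order. Adding suitable
earlier polynomials to the other `e` makes them `A * G * W i` with `W i` monic of degree `i`, and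
these contribute `G(0) ^ e`. Each formula then comes from the value of `G` at `0`. -/

open Polynomial

/-! ### Chebyshev-type sequences -/

/-- Bi-infinite sequences of polynomials with the three-term recurrence of the Chebyshev
polynomials in the variable `X - 2`. -/
def IsChebRec (f : ℤ → ℤ[X]) : Prop :=
  ∀ n, f (n + 1) = (X - 2) * f n - f (n - 1)

namespace IsChebRec

variable {f g : ℤ → ℤ[X]}

/-- The recurrence runs both ways, so two adjacent values fix a sequence. The product identities
below are checked this way, at indices `0` and `-1` only. -/
theorem ext (hf : IsChebRec f) (hg : IsChebRec g) (h0 : f 0 = g 0) (h1 : f (-1) = g (-1)) (n : ℤ) :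
    f n = g n := by
  have key : ∀ n : ℕ, (f n = g n ∧ f (n - 1) = g (n - 1)) ∧
      (f (-n) = g (-n) ∧ f (-n - 1) = g (-n - 1)) := by
    intro n
    induction n with
    | zero => simp [h0, h1]
    | succ n ih =>
      obtain ⟨⟨a, b⟩, c, d⟩ := ih
      have hf1 := hf n
      have hg1 := hg n
      have hf2 := hf (-n - 1)
      have hg2 := hg (-n - 1)
      rw [a, b] at hf1
      rw [sub_add_cancel, c, d] at hf2
      rw [sub_add_cancel] at hg2
      have e1 : (-((n + 1 : ℕ) : ℤ)) = -n - 1 := by push_cast; ring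
      have e2 : (((n + 1 : ℕ) : ℤ)) - 1 = n := by push_cast; ring
      rw [e1, e2]
      refine ⟨⟨?_, a⟩, d, ?_⟩
      · push_cast; rw [hf1, hg1]
      · linear_combination hf2 - hg2
  rcases n.eq_nat_or_neg with ⟨m, rfl | rfl⟩
  · exact (key m).1.1
  · exact (key m).2.1

theorem add (hf : IsChebRec f) (hg : IsChebRec g) : IsChebRec fun n => f n + g n := fun n => by
  linear_combination hf n + hg n

theorem sub (hf : IsChebRec f) (hg : IsChebRec g) : IsChebRec fun n => f n - g n := fun n => by
  linear_combination hf n - hg n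

theorem mul (hf : IsChebRec f) (p : ℤ[X]) : IsChebRec fun n => p * f n := fun n => by
  linear_combination p * hf n

theorem shift (hf : IsChebRec f) (c : ℤ) : IsChebRec fun n => f (n + c) := fun n => by
  have h := hf (n + c)
  rw [show n + c + 1 = n + 1 + c by ring, show n + c - 1 = n - 1 + c by ring] at h
  exact h

theorem reflect (hf : IsChebRec f) (c : ℤ) : IsChebRec fun n => f (c - n) := fun n => by
  have h := hf (c - n)
  rw [show c - n + 1 = c - (n - 1) by ring, show c - n - 1 = c - (n + 1) by ring] at h
  linear_combination h

end IsChebRec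

/-- With `X = w + 2 + w⁻¹` this is `(w ^ n - w ^ (-n)) / (w - w⁻¹)`. -/
noncomputable def chebS (n : ℤ) : ℤ[X] := (Chebyshev.S ℤ (n - 1)).comp (X - 2)

/-- With `X = w + 2 + w⁻¹` this is
`(w ^ (n + 1/2) + w ^ (-n - 1/2)) / (w ^ (1/2) + w ^ (-1/2))`. -/
noncomputable def chebP (n : ℤ) : ℤ[X] := chebS (n + 1) - chebS n

/-- With `X = w + 2 + w⁻¹` this is
`(w ^ (n + 1/2) - w ^ (-n - 1/2)) / (w ^ (1/2) - w ^ (-1/2))`. -/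
noncomputable def chebW (n : ℤ) : ℤ[X] := chebS (n + 1) + chebS n

/-- With `X = w + 2 + w⁻¹` this is `w ^ n + w ^ (-n)`. -/
noncomputable def chebT (n : ℤ) : ℤ[X] := chebP n + chebP (n - 1)

theorem isChebRec_chebS : IsChebRec chebS := fun n => by
  have h := Chebyshev.S_add_one ℤ (n - 1)
  rw [sub_add_cancel] at h
  simp [chebS, h]

theorem isChebRec_chebP : IsChebRec chebP :=
  (isChebRec_chebS.shift 1).sub isChebRec_chebS

theorem isChebRec_chebW : IsChebRec chebW :=
  (isChebRec_chebS.shift 1).add isChebRec_chebS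

theorem isChebRec_chebT : IsChebRec chebT :=
  isChebRec_chebP.add (isChebRec_chebP.shift (-1))

@[simp] theorem chebS_zero : chebS 0 = 0 := by simp [chebS]

@[simp] theorem chebS_one : chebS 1 = 1 := by simp [chebS]

@[simp] theorem chebS_neg_one : chebS (-1) = -1 := by simp [chebS]

@[simp] theorem chebP_zero : chebP 0 = 1 := by simp [chebP]

@[simp] theorem chebP_neg_one : chebP (-1) = 1 := by simp [chebP]

@[simp] theorem chebW_zero : chebW 0 = 1 := by simp [chebW]

@[simp] theorem chebW_neg_one : chebW (-1) = -1 := by simp [chebW]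

@[simp] theorem chebT_zero : chebT 0 = 2 := by simp [chebT]; norm_num

@[simp] theorem chebT_neg_one : chebT (-1) = X - 2 := by
  have := isChebRec_chebP (-1)
  simp only [chebT, Int.reduceSub, Int.reduceNeg, Int.reduceAdd, chebP_zero, chebP_neg_one] at *
  linear_combination this

/-! ### Reflection and product identities -/

theorem chebP_neg (n : ℤ) : chebP (-1 - n) = chebP n :=
  (isChebRec_chebP.reflect (-1)).ext isChebRec_chebP (by simp) (by simp) n

theorem chebP_add_chebP_sub (c i : ℤ) : chebP (c + i) + chebP (c - i) = chebP c * chebT i := by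
  rw [add_comm c i]
  refine ((isChebRec_chebP.shift c).add (isChebRec_chebP.reflect c)).ext
    (isChebRec_chebT.mul (chebP c)) ?_ ?_ i
  · simp; ring
  · have := isChebRec_chebP c
    simp only [chebT_neg_one, sub_neg_eq_add, neg_add_eq_sub]
    linear_combination this

theorem chebP_add_chebP_reflect (c i : ℤ) :
    chebP (c + i) + chebP (c - 1 - i) = chebT c * chebP i := by
  rw [add_comm c i]
  refine ((isChebRec_chebP.shift c).add (isChebRec_chebP.reflect (c - 1))).ext
    (isChebRec_chebP.mul (chebT c)) ?_ ?_ i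
  · simp [chebT]
  · simp [chebT, neg_add_eq_sub]; ring

theorem chebP_sub_chebP_pred (c : ℤ) : chebP c - chebP (c - 1) = chebS c * (X - 4) := by
  have := isChebRec_chebS c
  simp only [chebP, sub_add_cancel]
  linear_combination this

theorem chebP_sub_chebP_reflect (c i : ℤ) :
    chebP (c + i) - chebP (c - 1 - i) = chebS c * (X - 4) * chebW i := by
  rw [add_comm c i]
  have h := chebP_sub_chebP_pred c
  refine ((isChebRec_chebP.shift c).sub (isChebRec_chebP.reflect (c - 1))).ext
    (isChebRec_chebW.mul (chebS c * (X - 4))) ?_ ?_ i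
  · simpa using h
  · simp only [chebW_neg_one, neg_add_eq_sub, sub_neg_eq_add, sub_add_cancel]
    linear_combination -h

theorem chebS_add_chebS_sub (c k : ℤ) : chebS (c + k) + chebS (c - k) = chebS c * chebT k := by
  rw [add_comm c k]
  refine ((isChebRec_chebS.shift c).add (isChebRec_chebS.reflect c)).ext
    (isChebRec_chebT.mul (chebS c)) ?_ ?_ k
  · simp; ring
  · have := isChebRec_chebS c
    simp only [chebT_neg_one, sub_neg_eq_add, neg_add_eq_sub]
    linear_combination this

theorem chebS_add_chebS_reflect (c k : ℤ) :
    chebS (c + 1 + k) + chebS (c - k) = chebW c * chebP k := by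
  rw [add_comm (c + 1) k]
  refine ((isChebRec_chebS.shift (c + 1)).add (isChebRec_chebS.reflect c)).ext
    (isChebRec_chebP.mul (chebW c)) ?_ ?_ k
  · simp [chebW]
  · simp [chebW]; ring_nf

/-! ### Antiperiodicity and divisibility -/

/-- Modulo `chebP k`, reflection about `k` changes the sign of the sequence, while reflection about
`-1/2` preserves it. Their composite is the shift by `2k + 1`. -/
theorem chebP_dvd_chebP_add_period (k i : ℤ) (n : ℕ) :
    chebP k ∣ chebP ((2 * k + 1) * n + i) - (-1) ^ n * chebP i := by
  induction n with
  | zero => simp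
  | succ n ih =>
    have h := chebP_add_chebP_sub k ((2 * k + 1) * n + i + k + 1)
    have h2 := chebP_neg ((2 * k + 1) * n + i)
    rw [show k - ((2 * k + 1) * n + i + k + 1) = -1 - ((2 * k + 1) * n + i) by ring, h2,
      show k + ((2 * k + 1) * n + i + k + 1) = (2 * k + 1) * ((n + 1 : ℕ) : ℤ) + i by
        push_cast; ring] at h
    obtain ⟨q, hq⟩ := ih
    exact ⟨chebT ((2 * k + 1) * n + i + k + 1) - q, by linear_combination h - hq⟩

theorem chebT_dvd_chebP_add_period (k i : ℤ) (n : ℕ) :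
    chebT k ∣ chebP (2 * k * n + i) - (-1) ^ n * chebP i := by
  induction n with
  | zero => simp
  | succ n ih =>
    have h := chebP_add_chebP_reflect k (2 * k * n + i + k)
    have h2 := chebP_neg (2 * k * n + i)
    rw [show k - 1 - (2 * k * n + i + k) = -1 - (2 * k * n + i) by ring, h2,
      show k + (2 * k * n + i + k) = 2 * k * ((n + 1 : ℕ) : ℤ) + i by
        push_cast; ring] at h
    obtain ⟨q, hq⟩ := ih
    exact ⟨chebP (2 * k * n + i + k) - q, by linear_combination h - hq⟩

theorem chebP_dvd_chebP (k : ℤ) (n : ℕ) : chebP k ∣ chebP ((2 * k + 1) * n + k) :=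
  (dvd_sub_left (Dvd.intro_left _ rfl)).1 (chebP_dvd_chebP_add_period k k n)

theorem chebT_dvd_chebT (k : ℤ) (n : ℕ) : chebT k ∣ chebT (2 * k * n + k) := by
  have h := dvd_add (chebT_dvd_chebP_add_period k k n) (chebT_dvd_chebP_add_period k (k - 1) n)
  rw [← add_sub_assoc] at h
  refine (dvd_sub_left (c := (-1) ^ n * chebT k) (Dvd.intro_left _ rfl)).1 ?_
  convert h using 1
  simp only [chebT]
  ring_nf

theorem chebT_dvd_chebS (k : ℤ) (n : ℕ) : chebT k ∣ chebS (2 * k * n) := by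
  induction n with
  | zero => simp
  | succ n ih =>
    have h := chebS_add_chebS_sub (2 * k * n + k) k
    rw [add_sub_cancel_right] at h
    obtain ⟨q, hq⟩ := ih
    refine ⟨chebS (2 * k * n + k) - q, ?_⟩
    rw [show 2 * k * ((n + 1 : ℕ) : ℤ) = 2 * k * n + k + k by push_cast; ring]
    linear_combination h - hq

theorem chebP_dvd_chebS (k : ℤ) (n : ℕ) : chebP k ∣ chebS ((2 * k + 1) * n) := by
  induction n with
  | zero => simp
  | succ n ih =>
    have h := chebS_add_chebS_reflect ((2 * k + 1) * n + k) k
    rw [add_sub_cancel_right] at h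
    obtain ⟨q, hq⟩ := ih
    refine ⟨chebW ((2 * k + 1) * n + k) - q, ?_⟩
    rw [show (2 * k + 1) * ((n + 1 : ℕ) : ℤ) = (2 * k + 1) * n + k + 1 + k by push_cast; ring]
    linear_combination h - hq

/-! ### Values at `0`, leading coefficients and degrees -/

theorem eval_zero_chebS (n : ℕ) : (chebS n).eval 0 = -((-1) ^ n * n) := by
  have key : (chebS n).eval 0 = -((-1) ^ n * n) ∧
      (chebS (n + 1)).eval 0 = (-1) ^ n * (n + 1) := by
    induction n with
    | zero => simp
    | succ n ih =>
      have h := congrArg (eval 0) (isChebRec_chebS (n + 1))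
      simp only [eval_sub, eval_mul, eval_X, eval_ofNat, add_sub_cancel_right, ih] at h
      push_cast
      refine ⟨?_, ?_⟩
      · rw [ih.2]; ring
      · rw [h]; ring
  exact key.1

theorem eval_zero_chebP (n : ℕ) : (chebP n).eval 0 = (-1) ^ n * (2 * n + 1) := by
  have h := eval_zero_chebS (n + 1)
  push_cast at h
  rw [chebP, eval_sub, eval_zero_chebS, h]
  ring

theorem eval_zero_chebT (n : ℕ) : (chebT n).eval 0 = (-1) ^ n * 2 := by
  cases n with
  | zero => simp
  | succ n =>
    have h := eval_zero_chebP (n + 1)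
    push_cast at h ⊢
    rw [chebT, eval_add, add_sub_cancel_right, eval_zero_chebP, h]
    ring

theorem IsChebRec.monic_and_natDegree {f : ℤ → ℤ[X]} (hf : IsChebRec f) {c : ℤ} (h0 : f 0 = 1)
    (h1 : f (-1) = C c) (n : ℕ) : (f n).Monic ∧ (f n).natDegree = n := by
  -- The bound is `n + 1`, not `n`, because `f (-1)` may be a nonzero constant.
  have key : ∀ n : ℕ, (f n).Monic ∧ (f n).natDegree = n ∧ (f (n - 1)).degree < (n + 1 : ℕ) := by
    intro n
    induction n with
    | zero =>
      simp only [Nat.cast_zero, h0, zero_sub, h1, zero_add, monic_one, natDegree_one, true_and]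
      exact degree_C_le.trans_lt (by norm_num)
    | succ n ih =>
      obtain ⟨a, b, c⟩ := ih
      have m : (X - 2 : ℤ[X]).Monic := monic_X_sub_C (2 : ℤ)
      have d : (X - 2 : ℤ[X]).natDegree = 1 := natDegree_X_sub_C (2 : ℤ)
      have e : ((X - 2) * f n).natDegree = n + 1 := by rw [m.natDegree_mul a, d, b, add_comm]
      have lt : (f (n - 1)).degree < ((X - 2) * f n).degree := by
        rwa [degree_eq_natDegree (m.mul a).ne_zero, e]
      push_cast
      rw [hf n, add_sub_cancel_right]
      refine ⟨(m.mul a).sub_of_left lt, ?_, ?_⟩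
      · rw [natDegree_eq_of_degree_eq (degree_sub_eq_left_of_degree_lt lt), e]
      · rw [degree_eq_natDegree a.ne_zero, b]
        norm_cast
        omega
  exact ⟨(key n).1, (key n).2.1⟩

theorem chebP_monic (n : ℕ) : (chebP n).Monic :=
  (isChebRec_chebP.monic_and_natDegree (c := 1) (by simp) (by simp) n).1

theorem natDegree_chebP (n : ℕ) : (chebP n).natDegree = n :=
  (isChebRec_chebP.monic_and_natDegree (c := 1) (by simp) (by simp) n).2

theorem chebW_monic (n : ℕ) : (chebW n).Monic :=
  (isChebRec_chebW.monic_and_natDegree (c := -1) (by simp) (by simp) n).1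

theorem natDegree_chebW (n : ℕ) : (chebW n).natDegree = n :=
  (isChebRec_chebW.monic_and_natDegree (c := -1) (by simp) (by simp) n).2

theorem chebT_monic_and_natDegree {n : ℕ} (hn : 1 ≤ n) :
    (chebT n).Monic ∧ (chebT n).natDegree = n := by
  obtain ⟨m, rfl⟩ := Nat.exists_eq_add_of_le' hn
  have h : chebT (m + 1 : ℕ) = chebP (m + 1 : ℕ) + chebP m := by simp [chebT]
  have lt : (chebP m).degree < (chebP (m + 1 : ℕ)).degree := by
    rw [degree_eq_natDegree (chebP_monic _).ne_zero, degree_eq_natDegree (chebP_monic _).ne_zero,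
      natDegree_chebP, natDegree_chebP]
    norm_cast
    omega
  rw [h]
  exact ⟨(chebP_monic _).add_of_left lt,
    (natDegree_eq_of_degree_eq (degree_add_eq_left_of_degree_lt lt)).trans (natDegree_chebP _)⟩

/-! ### Signs of two permutations -/

/-- The sign of the permutation that exchanges an initial and a final segment. -/
theorem Equiv.Perm.sign_finAddFlip (m n : ℕ) :
    Equiv.Perm.sign ((finAddFlip : Fin (m + n) ≃ Fin (n + m)).trans
      (finCongr (add_comm n m))) = (-1) ^ (m * n) := by
  rw [Equiv.Perm.sign_eq_prod_prod_Ioi]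
  simp_rw [← finSumFinEquiv.prod_comp, ← Finset.prod_map_equiv finSumFinEquiv.symm]
  simp only [← Fin.val_fin_lt, Equiv.symm_symm, Function.comp_apply,
    ← Finset.prod_ite_mem_eq (Finset.map _ _), Finset.mem_map_equiv, Finset.mem_Ioi,
    Fintype.prod_sum_type, finSumFinEquiv_apply_left, Fin.val_castAdd,
    finSumFinEquiv_apply_right, Fin.val_natAdd, add_lt_add_iff_left,
    Equiv.trans_apply, finCongr_apply, Fin.val_cast, finAddFlip_apply_castAdd,
    finAddFlip_apply_natAdd,
    ← ite_not (p := _ < _) (y := (1 : ℤˣ)), ← ite_and, and_not_self]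
  simp [(Fin.isLt _).trans_le, (Fin.isLt _).le.trans]
  rw [← pow_mul, mul_comm]

theorem Equiv.Perm.sign_finRevPerm (n : ℕ) :
    Equiv.Perm.sign (Fin.revPerm : Equiv.Perm (Fin n)) = (-1) ^ n.choose 2 := by
  rw [Equiv.Perm.sign_eq_prod_prod_Iio]
  have : ∀ j : Fin n, ∏ i ∈ Finset.Iio j,
      (if Fin.revPerm i < Fin.revPerm j then 1 else -1 : ℤˣ) = (-1) ^ (j : ℕ) := fun j => by
    rw [Finset.prod_congr rfl (g := fun _ => -1), Finset.prod_const, Fin.card_Iio]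
    intro i hi
    rw [Finset.mem_Iio] at hi
    simp [hi.le]
  rw [Finset.prod_congr rfl fun j _ => this j, Finset.prod_pow_eq_pow_sum,
    Fin.sum_univ_eq_sum_range (fun i => i), Finset.sum_range_id, Nat.choose_two_right]

/-! ### Determinants of coefficient matrices -/

section CoeffMatrix

variable {R : Type*} [CommRing R]

/-- The square matrix of the low coefficients of a finite family of polynomials. -/
def coeffMatrix {s : ℕ} (f : Fin s → R[X]) : Matrix (Fin s) (Fin s) R :=
  Matrix.of fun i j => (f i).coeff j

theorem coeffMatrix_apply {s : ℕ} (f : Fin s → R[X]) (i j : Fin s) :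
    coeffMatrix f i j = (f i).coeff j := rfl

theorem sum_fin_C_coeff_mul {s : ℕ} {p : R[X]} (hp : p.degree < s) (q : R[X]) :
    ∑ a : Fin s, C (p.coeff a) * (q * X ^ (a : ℕ)) = q * p := by
  have h : p = ∑ a ∈ Finset.range s, C (p.coeff a) * X ^ a := by
    rcases eq_or_ne p 0 with rfl | h0
    · simp
    · exact as_sum_range_C_mul_X_pow' _ ((natDegree_lt_iff_degree_lt h0).2 hp)
  conv_rhs => rw [h, Finset.mul_sum]
  rw [Fin.sum_univ_eq_sum_range fun a => C (p.coeff a) * (q * X ^ a)]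
  exact Finset.sum_congr rfl fun a _ => by ring

theorem mul_coeffMatrix {s : ℕ} (M : Matrix (Fin s) (Fin s) R) {f g : Fin s → R[X]}
    (h : ∀ i, g i = ∑ a, C (M i a) * f a) : M * coeffMatrix f = coeffMatrix g := by
  ext i j
  simp [Matrix.mul_apply, coeffMatrix_apply, h]

theorem det_coeffMatrix_of_monic {s : ℕ} {f : Fin s → R[X]} (hf : ∀ i, (f i).Monic)
    (hd : ∀ i, (f i).natDegree = i) : (coeffMatrix f).det = 1 := by
  rw [Matrix.det_of_isLowerTriangular]
  · refine Finset.prod_eq_one fun i _ => ?_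
    have := (hf i).coeff_natDegree
    rwa [hd] at this
  · intro i j hij
    exact coeff_eq_zero_of_natDegree_lt (by rw [hd]; exact hij)

/-- In the basis `1, ..., X ^ (d - 1), A, A * X, ..., A * X ^ (e - 1)`, which is unitriangular over
the monomials, the family is block triangular with diagonal blocks given by `r` and `g`. -/
theorem det_coeffMatrix_append {d e : ℕ} {A : R[X]} (hA : A.Monic) (hd : A.natDegree = d)
    {f r : Fin d → R[X]} {g : Fin e → R[X]} (hf : ∀ i, (f i).degree < (d + e : ℕ))
    (hr : ∀ i, (r i).degree < d) (hfr : ∀ i, A ∣ f i - r i) (hg : ∀ i, (g i).degree < e) :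
    (coeffMatrix (Fin.append f fun i => A * g i)).det =
      (coeffMatrix r).det * (coeffMatrix g).det := by
  nontriviality R
  choose q hq using hfr
  have hq' : ∀ i, (q i).degree < e := fun i => by
    have h : (A * q i).degree < (d + e : ℕ) := by
      rw [← hq]
      refine (degree_sub_le _ _).trans_lt (max_lt (hf i) ((hr i).trans_le ?_))
      exact_mod_cast Nat.le_add_right d e
    rw [mul_comm, hA.degree_mul, degree_eq_natDegree hA.ne_zero, hd, add_comm] at h
    by_contra! hc
    refine absurd h (not_lt.2 ?_)
    push_cast
    gcongr
  set B : Fin (d + e) → R[X] :=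
    Fin.append (fun i : Fin d => X ^ (i : ℕ)) fun i : Fin e => A * X ^ (i : ℕ) with hB
  have hB1 : (coeffMatrix B).det = 1 := by
    apply det_coeffMatrix_of_monic
    · intro i
      refine Fin.addCases (fun i => ?_) (fun i => ?_) i
      · simp [hB]
      · simpa [hB] using hA.mul (monic_X_pow _)
    · intro i
      refine Fin.addCases (fun i => ?_) (fun i => ?_) i
      · simp [hB]
      · simp [hB, hA.natDegree_mul (monic_X_pow _), hd]
  set M : Matrix (Fin d ⊕ Fin e) (Fin d ⊕ Fin e) R :=
    Matrix.fromBlocks (coeffMatrix r) (Matrix.of fun i j => (q i).coeff j) 0 (coeffMatrix g)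
  have hM : M.reindex finSumFinEquiv finSumFinEquiv * coeffMatrix B =
      coeffMatrix (Fin.append f fun i => A * g i) := by
    apply mul_coeffMatrix
    intro i
    rw [← finSumFinEquiv.sum_comp, Fintype.sum_sum_type]
    refine Fin.addCases (fun i => ?_) (fun i => ?_) i
    · have h1 := sum_fin_C_coeff_mul (hr i) 1
      have h2 := sum_fin_C_coeff_mul (hq' i) A
      simp only [one_mul] at h1
      simp [M, hB, coeffMatrix_apply, h1, h2, ← hq]
    · have h2 := sum_fin_C_coeff_mul (hg i) A
      simp [M, hB, coeffMatrix_apply, h2]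
  rw [← hM, Matrix.det_mul, hB1, mul_one, Matrix.det_reindex_self, Matrix.det_fromBlocks_zero₂₁]

theorem det_coeffMatrix_append_add {d e : ℕ} (f : Fin d → R[X]) (g : Fin e → R[X])
    (c : Fin e → Fin d → R) :
    (coeffMatrix (Fin.append f fun i => g i + ∑ j, C (c i j) * f j)).det =
      (coeffMatrix (Fin.append f g)).det := by
  set M : Matrix (Fin d ⊕ Fin e) (Fin d ⊕ Fin e) R := Matrix.fromBlocks 1 0 (Matrix.of c) 1
  have hM : M.reindex finSumFinEquiv finSumFinEquiv * coeffMatrix (Fin.append f g) =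
      coeffMatrix (Fin.append f fun i => g i + ∑ j, C (c i j) * f j) := by
    apply mul_coeffMatrix
    intro i
    rw [← finSumFinEquiv.sum_comp, Fintype.sum_sum_type]
    refine Fin.addCases (fun i => ?_) (fun i => ?_) i
    · simp [M, Matrix.one_apply, apply_ite C]
    · simp [M, Matrix.one_apply, apply_ite C, add_comm]
  rw [← hM, Matrix.det_mul, Matrix.det_reindex_self, Matrix.det_fromBlocks_zero₁₂]
  simp

/-- Modulo `X ^ e` the matrix factors as the unitriangular matrix of `W` times the triangular
Toeplitz matrix of `G`, whose diagonal is `G(0)`. -/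
theorem det_coeffMatrix_mul {e : ℕ} (G : R[X]) {W g : Fin e → R[X]} (hW : ∀ i, (W i).Monic)
    (hd : ∀ i, (W i).natDegree = i) (hg : ∀ i, X ^ e ∣ G * W i - g i) :
    (coeffMatrix g).det = G.coeff 0 ^ e := by
  nontriviality R
  have h1 : coeffMatrix g = coeffMatrix fun i => G * W i := by
    ext i j
    have := (X_pow_dvd_iff.1 (hg i)) j j.2
    rw [coeff_sub, sub_eq_zero] at this
    exact this.symm
  have h2 : coeffMatrix W * coeffMatrix (fun a : Fin e => G * X ^ (a : ℕ)) =
      coeffMatrix fun i => G * W i := by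
    apply mul_coeffMatrix
    intro i
    refine (sum_fin_C_coeff_mul ?_ G).symm
    rw [degree_eq_natDegree (hW i).ne_zero, hd]
    exact_mod_cast i.2
  rw [h1, ← h2, Matrix.det_mul, det_coeffMatrix_of_monic hW hd, one_mul,
    Matrix.det_of_isUpperTriangular]
  · simp [coeffMatrix_apply, coeff_mul_X_pow']
  · intro i j hij
    have : (j : ℕ) < i := hij
    simp [coeffMatrix_apply, coeff_mul_X_pow', this.not_ge]

/-! ### Christoffel's formula and the splitting of its right-hand side -/

/-- Christoffel's formula: the Hankel determinant of the functional `p ↦ Λ (Q * p)` in terms of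
the orthogonal polynomials of `Λ`. -/
theorem det_hankel_mul {Λ : R[X] →ₗ[R] R} {P : ℕ → R[X]} (hP : ∀ n, (P n).Monic)
    (hd : ∀ n, (P n).natDegree = n) (h0 : ∀ n s, s < n → Λ (P n * X ^ s) = 0)
    (h1 : ∀ n, Λ (P n * X ^ n) = 1) {Q : R[X]} (hQ : Q.Monic) {m : ℕ} (hm : Q.natDegree = m)
    (N : ℕ) :
    (Matrix.of fun i j : Fin N => Λ (Q * X ^ (i + j : ℕ))).det =
      (-1) ^ (m * N) * (coeffMatrix fun j : Fin m => P (N + j) %ₘ Q).det := by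
  nontriviality R
  have hmul : ∀ {s : ℕ} (F : Fin s → R[X]), (∀ i, (F i).degree < s) →
      coeffMatrix F * Matrix.of (fun i j : Fin s => Λ (X ^ (i + j : ℕ))) =
        Matrix.of fun i j : Fin s => Λ (F i * X ^ (j : ℕ)) := by
    intro s F hF
    ext i j
    have h := sum_fin_C_coeff_mul (hF i) (X ^ (j : ℕ))
    rw [Matrix.of_apply, mul_comm (F i), ← h, map_sum, Matrix.mul_apply]
    refine Finset.sum_congr rfl fun a _ => ?_
    rw [← smul_eq_C_mul, map_smul, smul_eq_mul, ← pow_add, add_comm (j : ℕ)]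
    rfl
  have hdeg : ∀ n, (P n).degree = n := fun n => by
    rw [degree_eq_natDegree (hP n).ne_zero, hd]
  have hH : ∀ s, (Matrix.of fun i j : Fin s => Λ (X ^ (i + j : ℕ))).det = 1 := by
    intro s
    have h := congrArg Matrix.det (hmul (fun i : Fin s => P i) fun i => by
      rw [hdeg]; exact_mod_cast i.2)
    rw [Matrix.det_mul, det_coeffMatrix_of_monic (fun i => hP i) fun i => hd i, one_mul] at h
    rw [h, Matrix.det_of_isUpperTriangular]
    · simp [h1]
    · intro i j hij
      exact h0 _ _ hij
  -- The matrix `Λ (F i * X ^ j)` is evaluated twice: as coefficients of `F` times a Hankel matrix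
  -- of determinant `1`, and as a block matrix using orthogonality.
  set F : Fin (m + N) → R[X] :=
    Fin.append (fun j : Fin m => P (N + j)) fun i : Fin N => Q * X ^ (i : ℕ) with hF
  have hFdeg : ∀ i, (F i).degree < (m + N : ℕ) := by
    intro i
    refine Fin.addCases (fun i => ?_) (fun i => ?_) i
    · have := i.2
      simp only [hF, Fin.append_left, hdeg]
      norm_cast
      omega
    · have := i.2
      simp only [hF, Fin.append_right]
      rw [(monic_X_pow _).degree_mul, degree_X_pow, degree_eq_natDegree hQ.ne_zero, hm]
      norm_cast
      omega
  have hcoeff : (coeffMatrix F).det = (coeffMatrix fun j : Fin m => P (N + j) %ₘ Q).det := by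
    rw [hF, det_coeffMatrix_append (r := fun j : Fin m => P (N + j) %ₘ Q) hQ hm,
      det_coeffMatrix_of_monic (f := fun i : Fin N => X ^ (i : ℕ)), mul_one]
    · exact fun i => monic_X_pow _
    · simp
    · intro i
      simpa [hF] using hFdeg (Fin.castAdd N i)
    · intro i
      have h := degree_modByMonic_lt (P (N + i)) hQ
      rwa [degree_eq_natDegree hQ.ne_zero, hm] at h
    · intro i
      exact ⟨P (N + i) /ₘ Q, by linear_combination -modByMonic_add_div (P (N + i)) Q⟩
    · intro i
      rw [degree_X_pow]
      exact_mod_cast i.2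
  set M : Matrix (Fin (m + N)) (Fin (m + N)) R := Matrix.of fun i j => Λ (F i * X ^ (j : ℕ))
    with hM
  have hMdet : M.det = (coeffMatrix fun j : Fin m => P (N + j) %ₘ Q).det := by
    rw [hM, ← hmul F hFdeg, Matrix.det_mul, hH, mul_one, hcoeff]
  -- Moving the last `m` columns to the front exposes the zero block `Λ (P (N + i) * X ^ j)`, `j <
  -- N`, at the cost of the sign `(-1) ^ (m * N)`.
  set σ : Equiv.Perm (Fin (m + N)) := finAddFlip.trans (finCongr (add_comm N m)) with hσ
  have hblock : (M.submatrix id σ).submatrix finSumFinEquiv finSumFinEquiv =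
      Matrix.fromBlocks (Matrix.of fun i j : Fin m => Λ (P (N + i) * X ^ (N + j : ℕ))) 0
        (Matrix.of fun (i : Fin N) (j : Fin m) => Λ (Q * X ^ (i : ℕ) * X ^ (N + j : ℕ)))
        (Matrix.of fun i j : Fin N => Λ (Q * X ^ (i + j : ℕ))) := by
    ext i j
    rcases i with i | i <;> rcases j with j | j
    · simp [hM, hσ, hF, add_comm]
    · simp only [hM, hσ, hF]
      simp [h0 (N + i) j (by omega)]
    · simp [hM, hσ, hF, add_comm]
    · simp [hM, hσ, hF, pow_add, mul_assoc]
  have hU : (Matrix.of fun i j : Fin m => Λ (P (N + i) * X ^ (N + j : ℕ))).det = 1 := by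
    rw [Matrix.det_of_isUpperTriangular]
    · simp [h1]
    · intro i j hij
      exact h0 _ _ (by have : (j : ℕ) < i := hij; omega)
  have hdet := congrArg Matrix.det hblock
  rw [Matrix.det_submatrix_equiv_self, Matrix.det_permute', Matrix.det_fromBlocks_zero₁₂, hU,
    one_mul, hσ, Equiv.Perm.sign_finAddFlip, hMdet] at hdet
  simpa using hdet.symm

/-- Row operations by `c` survive reduction modulo `A * X ^ e`, and `A * (G * W i)` reduces to `A`
times the remainder of `G * W i` modulo `X ^ e`. The two preceding determinant computations then
apply. -/
theorem det_coeffMatrix_append_modByMonic {d e : ℕ} {A : R[X]} (hA : A.Monic)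
    (hd : A.natDegree = d) {f r : Fin d → R[X]} {g W : Fin e → R[X]} {G : R[X]}
    (hr : ∀ i, (r i).degree < d) (hfr : ∀ i, A ∣ f i - r i) (hW : ∀ i, (W i).Monic)
    (hWd : ∀ i, (W i).natDegree = i)
    (hg : ∀ i, ∃ c : Fin d → R, g i + ∑ j, C (c j) * f j = A * (G * W i)) :
    (coeffMatrix fun j => Fin.append f g j %ₘ (A * X ^ e)).det =
      (coeffMatrix r).det * G.coeff 0 ^ e := by
  nontriviality R
  choose c hc using hg
  set Q := A * X ^ e with hQ
  have hX : (X ^ e : R[X]).Monic := monic_X_pow e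
  have hQm : Q.Monic := hA.mul hX
  have hQd : Q.degree = (d + e : ℕ) := by
    rw [degree_eq_natDegree hQm.ne_zero, hA.natDegree_mul hX, hd, natDegree_X_pow]
  have h1 : (fun j => Fin.append f g j %ₘ Q) =
      Fin.append (fun i => f i %ₘ Q) fun i => g i %ₘ Q := by
    ext1 j
    refine Fin.addCases (fun i => ?_) (fun i => ?_) j <;> simp
  have hlt : ∀ i, ((G * W i) %ₘ X ^ e).degree < e := fun i => by
    have h := degree_modByMonic_lt (G * W i) hX
    rwa [degree_X_pow] at h
  have h2 : ∀ i, g i %ₘ Q + ∑ j, C (c i j) * (f j %ₘ Q) = A * ((G * W i) %ₘ X ^ e) := fun i => by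
    have h := congrArg (modByMonicHom Q) (hc i)
    simp only [map_add, map_sum, ← smul_eq_C_mul, map_smul, modByMonicHom_apply] at h
    simp only [← smul_eq_C_mul]
    rw [h]
    refine (div_modByMonic_unique ((G * W i) /ₘ X ^ e) _ hQm ⟨?_, ?_⟩).2
    · rw [hQ]
      linear_combination A * modByMonic_add_div (G * W i) (X ^ e)
    · rw [mul_comm, hA.degree_mul, hQ, mul_comm A, hA.degree_mul, degree_X_pow]
      exact WithBot.add_lt_add_right (by simpa using hA.ne_zero) (hlt i)
  rw [h1, ← det_coeffMatrix_append_add _ _ c]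
  simp only [h2]
  rw [det_coeffMatrix_append (r := r) hA hd _ hr _ hlt, det_coeffMatrix_mul G hW hWd]
  · intro i
    exact ⟨(G * W i) /ₘ X ^ e, by linear_combination -modByMonic_add_div (G * W i) (X ^ e)⟩
  · intro i
    rw [← hQd]
    exact degree_modByMonic_lt _ hQm
  · intro i
    obtain ⟨q, hq⟩ := hfr i
    refine ⟨q - X ^ e * (f i /ₘ Q), ?_⟩
    have := modByMonic_add_div (f i) Q
    linear_combination hq + this + (f i /ₘ Q) * hQ

theorem coeffMatrix_C_mul {s : ℕ} (ε : R) (f : Fin s → R[X]) :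
    (coeffMatrix fun i => C ε * f i) = ε • coeffMatrix f := by
  ext i j
  simp [coeffMatrix_apply]

theorem det_coeffMatrix_rev {s : ℕ} (f : Fin s → R[X]) :
    (coeffMatrix fun i => f i.rev).det = (-1) ^ s.choose 2 * (coeffMatrix f).det := by
  have h := Matrix.det_permute Fin.revPerm (coeffMatrix f)
  rw [Equiv.Perm.sign_finRevPerm] at h
  simp only [Units.val_pow_eq_pow_val, Units.val_neg, Units.val_one, Int.cast_pow, Int.cast_neg,
    Int.cast_one] at h
  exact h

end CoeffMatrix

/-! ### The moment functional -/

/-- The functional `X ^ m ↦ binom (2m + 1) m`, for which the polynomials `chebP n` are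
orthonormal. -/
noncomputable def oddBinomMoment : ℤ[X] →ₗ[ℤ] ℤ :=
  lsum fun m => ((2 * m + 1).choose m : ℤ) • LinearMap.id

theorem oddBinomMoment_X_pow (m : ℕ) :
    oddBinomMoment (X ^ m) = (2 * m + 1).choose m := by
  rw [oddBinomMoment, lsum_apply, X_pow_eq_monomial, sum_monomial_index] <;> simp

theorem choose_add_three (a b : ℕ) :
    (a + 2).choose (b + 2) = a.choose b + 2 * a.choose (b + 1) + a.choose (b + 2) := by
  simp only [Nat.choose_succ_succ']
  ring

/-- Multiplication by `X` acts as the doubled Pascal rule with weights `1, 2, 1`, matching the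
recurrence of `chebP`. This yields both orthonormality (the cases `s < k` and `s = k`) and the
moments of the modified functionals. -/
theorem oddBinomMoment_X_pow_mul_chebP (k s : ℕ) :
    oddBinomMoment (X ^ s * chebP k) = (2 * s + 1).choose (s + k + 1) := by
  have key : ∀ k : ℕ,
      (∀ s, oddBinomMoment (X ^ s * chebP k) = (2 * s + 1).choose (s + k + 1)) ∧
      ∀ s, oddBinomMoment (X ^ s * chebP (k - 1)) = (2 * s + 1).choose (s + k) := by
    intro k
    induction k with
    | zero =>
      have h : ∀ s : ℕ, (2 * s + 1).choose (s + 1) = (2 * s + 1).choose s := fun s =>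
        Nat.choose_symm_of_eq_add (by omega)
      simp [oddBinomMoment_X_pow, h]
    | succ k ih =>
      refine ⟨fun s => ?_, fun s => by simpa [add_assoc] using ih.1 s⟩
      have h : X ^ s * chebP (k + 1 : ℕ) =
          X ^ (s + 1) * chebP k - (2 : ℤ) • (X ^ s * chebP k) - X ^ s * chebP (k - 1) := by
        push_cast
        rw [isChebRec_chebP, smul_eq_C_mul]
        simp only [map_ofNat]
        ring
      rw [h, map_sub, map_sub, map_smul, ih.1, ih.1, ih.2,
        show 2 * (s + 1) + 1 = 2 * s + 1 + 2 by ring, show s + 1 + k + 1 = s + k + 2 by ring,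
        choose_add_three]
      push_cast
      rw [show s + (k + 1) + 1 = s + k + 2 by ring, smul_eq_mul]
      ring
  exact (key k).1 s

theorem oddBinomMoment_chebP (k m : ℕ) :
    oddBinomMoment (chebP k * X ^ k * X ^ m) = (2 * m + (2 * k + 1)).choose m := by
  rw [mul_assoc, ← pow_add, mul_comm, oddBinomMoment_X_pow_mul_chebP,
    show 2 * (k + m) + 1 = 2 * m + (2 * k + 1) by ring]
  congr 1
  exact Nat.choose_symm_of_eq_add (by omega)

theorem oddBinomMoment_chebT (k m : ℕ) :
    oddBinomMoment (chebT (k + 1 : ℕ) * X ^ k * X ^ m) = (2 * m + 2 * (k + 1)).choose m := by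
  have h : chebT (k + 1 : ℕ) * X ^ k * X ^ m =
      X ^ (m + k) * chebP (k + 1 : ℕ) + X ^ (m + k) * chebP k := by
    simp only [chebT, Nat.cast_add, Nat.cast_one, add_sub_cancel_right]
    ring
  rw [h, map_add, oddBinomMoment_X_pow_mul_chebP, oddBinomMoment_X_pow_mul_chebP]
  rw [← Nat.choose_symm_of_eq_add (show 2 * m + 2 * (k + 1) = (m + k + (k + 1) + 1) + m by ring),
    show 2 * m + 2 * (k + 1) = 2 * (m + k) + 1 + 1 by ring,
    show m + k + (k + 1) + 1 = m + k + k + 1 + 1 by ring, Nat.choose_succ_succ']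
  push_cast
  rw [add_comm]
  rfl

/-! ### Reduction of the Hankel determinants -/

theorem hankelDet_eq {r d e N : ℕ} {A G : ℤ[X]} {ρ : Fin d → ℤ[X]} {W : Fin e → ℤ[X]}
    (hA : A.Monic) (hd : A.natDegree = d)
    (hmom : ∀ m, oddBinomMoment (A * X ^ e * X ^ m) = (2 * m + r).choose m)
    (hr : ∀ i, (ρ i).degree < d) (hfr : ∀ i : Fin d, A ∣ chebP (N + i : ℕ) - ρ i)
    (hW : ∀ i, (W i).Monic) (hWd : ∀ i, (W i).natDegree = i)
    (hg : ∀ i : Fin e, ∃ c : Fin d → ℤ,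
      chebP (N + (d + i) : ℕ) + ∑ j : Fin d, C (c j) * chebP (N + j : ℕ) = A * (G * W i)) :
    hankelDet r N = (-1) ^ ((d + e) * N) * ((coeffMatrix ρ).det * G.eval 0 ^ e) := by
  have h0 : ∀ n s : ℕ, s < n → oddBinomMoment (chebP n * X ^ s) = 0 := fun n s hs => by
    rw [mul_comm, oddBinomMoment_X_pow_mul_chebP, Nat.choose_eq_zero_of_lt (by omega),
      Nat.cast_zero]
  have h1 : ∀ n : ℕ, oddBinomMoment (chebP n * X ^ n) = 1 := fun n => by
    rw [mul_comm, oddBinomMoment_X_pow_mul_chebP, ← two_mul, Nat.choose_self, Nat.cast_one]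
  have hX : (X ^ e : ℤ[X]).Monic := monic_X_pow e
  have h := det_hankel_mul (P := fun n => chebP n) chebP_monic natDegree_chebP h0 h1
    (hA.mul hX) (m := d + e) (by rw [hA.natDegree_mul hX, hd, natDegree_X_pow]) N
  rw [← coeff_zero_eq_eval_zero, ← det_coeffMatrix_append_modByMonic hA hd hr hfr hW hWd hg]
  have happ : (Fin.append (fun i : Fin d => chebP (N + i : ℕ))
      fun i : Fin e => chebP (N + (d + i) : ℕ)) = fun j : Fin (d + e) => chebP (N + j : ℕ) := by
    ext1 j
    refine Fin.addCases (fun i => ?_) (fun i => ?_) j <;> simp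
  rw [happ, ← h, hankelDet]
  congr 1
  ext i j
  rw [Matrix.of_apply, Matrix.of_apply, hmom, mul_add]

theorem hankelDet_eq_of_dvd_sub {r d e N : ℕ} {A G : ℤ[X]} {ε : ℤ} {W : Fin e → ℤ[X]}
    (hA : A.Monic) (hd : A.natDegree = d)
    (hmom : ∀ m, oddBinomMoment (A * X ^ e * X ^ m) = (2 * m + r).choose m)
    (hfr : ∀ i : ℕ, i < d → A ∣ chebP (N + i : ℕ) - C ε * chebP i)
    (hW : ∀ i, (W i).Monic) (hWd : ∀ i, (W i).natDegree = i)
    (hg : ∀ i : Fin e, ∃ c : Fin d → ℤ,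
      chebP (N + (d + i) : ℕ) + ∑ j : Fin d, C (c j) * chebP (N + j : ℕ) = A * (G * W i)) :
    hankelDet r N = (-1) ^ ((d + e) * N) * (ε ^ d * G.eval 0 ^ e) := by
  rw [hankelDet_eq (ρ := fun i : Fin d => C ε * chebP (i : ℕ)) hA hd hmom ?_
    (fun i => hfr i i.2) hW hWd hg, coeffMatrix_C_mul, Matrix.det_smul, Fintype.card_fin,
    det_coeffMatrix_of_monic (fun i => chebP_monic i) (fun i => natDegree_chebP i), mul_one]
  intro i
  rw [← smul_eq_C_mul]
  refine (degree_smul_le _ _).trans_lt ?_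
  rw [degree_eq_natDegree (chebP_monic _).ne_zero, natDegree_chebP]
  exact_mod_cast i.2

theorem hankelDet_eq_of_dvd_sub_rev {r d e N : ℕ} {A G : ℤ[X]} {ε : ℤ} {W : Fin e → ℤ[X]}
    (hA : A.Monic) (hd : A.natDegree = d)
    (hmom : ∀ m, oddBinomMoment (A * X ^ e * X ^ m) = (2 * m + r).choose m)
    (hfr : ∀ i : ℕ, i < d → A ∣ chebP (N + i : ℕ) - C ε * chebP (d - 1 - i))
    (hW : ∀ i, (W i).Monic) (hWd : ∀ i, (W i).natDegree = i)
    (hg : ∀ i : Fin e, ∃ c : Fin d → ℤ,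
      chebP (N + (d + i) : ℕ) + ∑ j : Fin d, C (c j) * chebP (N + j : ℕ) = A * (G * W i)) :
    hankelDet r N =
      (-1) ^ ((d + e) * N) * (ε ^ d * (-1) ^ d.choose 2 * G.eval 0 ^ e) := by
  have hrev : ∀ i : Fin d, ((i.rev : ℕ) : ℤ) = d - 1 - i := fun i => by
    have := i.2
    rw [Fin.val_rev]
    omega
  rw [hankelDet_eq (ρ := fun i : Fin d => C ε * chebP (i.rev : ℕ)) hA hd hmom ?_
    (fun i => by rw [hrev]; exact hfr i i.2) hW hWd hg, coeffMatrix_C_mul, Matrix.det_smul,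
    Fintype.card_fin, det_coeffMatrix_rev fun i : Fin d => chebP (i : ℕ),
    det_coeffMatrix_of_monic (fun i => chebP_monic i) (fun i => natDegree_chebP i), mul_one]
  intro i
  rw [← smul_eq_C_mul]
  refine (degree_smul_le _ _).trans_lt ?_
  rw [degree_eq_natDegree (chebP_monic _).ne_zero, natDegree_chebP]
  exact_mod_cast i.rev.2

/-- Just past half a period, reflection about `k` reverses the order of the remainders and changes
their sign. -/
theorem dvd_chebP_odd_rev (k n i : ℕ) :
    chebP k ∣ chebP ((2 * k + 1) * n + (k + 1 + i)) - C ((-1) ^ (n + 1)) * chebP (k - 1 - i) := by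
  have h1 := chebP_dvd_chebP_add_period k (k + 1 + i) n
  have h2 := chebP_add_chebP_sub k (1 + i)
  rw [← add_assoc, ← sub_sub] at h2
  obtain ⟨q, hq⟩ := h1
  refine ⟨q + (-1) ^ n * chebT (1 + i), ?_⟩
  simp only [map_pow, map_neg, map_one]
  linear_combination hq + (-1) ^ n * h2

theorem dvd_chebP_even_rev (k n i : ℕ) :
    chebT k ∣ chebP (2 * k * n + (k + i)) - C ((-1) ^ (n + 1)) * chebP (k - 1 - i) := by
  have h1 := chebT_dvd_chebP_add_period k (k + i) n
  have h2 := chebP_add_chebP_reflect k i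
  obtain ⟨q, hq⟩ := h1
  refine ⟨q + (-1) ^ n * chebP i, ?_⟩
  simp only [map_pow, map_neg, map_one]
  linear_combination hq + (-1) ^ n * h2

/-! ### The four evaluations -/

theorem hankelDet_odd_period (k n : ℕ) :
    hankelDet (2 * k + 1) ((2 * k + 1) * n) = (2 * (n : ℤ) + 1) ^ k := by
  obtain ⟨R, hR⟩ := chebP_dvd_chebP k n
  have hR0 : R.eval 0 = (-1) ^ n * (2 * n + 1) := by
    have h := congrArg (eval 0) hR
    have h1 := eval_zero_chebP ((2 * k + 1) * n + k)
    push_cast at h1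
    rw [h1, eval_mul, eval_zero_chebP, pow_add, pow_mul, Odd.neg_one_pow ⟨k, rfl⟩] at h
    have h2 : ((-1) ^ k * (2 * k + 1) : ℤ) ≠ 0 := mul_ne_zero (by simp) (by positivity)
    apply mul_left_cancel₀ h2
    rw [← h]
    ring
  -- The family `W` is `chebT i`, except that `chebT 0 = 2` is not monic; at `i = 0` the polynomial
  -- is already `A * G` and needs no partner.
  rw [hankelDet_eq_of_dvd_sub (A := chebP k) (G := R) (ε := (-1) ^ n) (d := k) (e := k)
    (W := fun i => if (i : ℕ) = 0 then 1 else chebT (i : ℕ)) (chebP_monic k) (natDegree_chebP k)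
    (oddBinomMoment_chebP k), hR0]
  · rw [← two_mul, mul_assoc, pow_mul, neg_one_sq, one_pow, one_mul, ← mul_pow, ← mul_assoc,
      ← mul_pow]
    simp
  · intro i hi
    have h := chebP_dvd_chebP_add_period k i n
    push_cast
    simpa using h
  · intro i
    by_cases hi : (i : ℕ) = 0
    · simp [hi]
    · simpa [hi] using (chebT_monic_and_natDegree (Nat.pos_of_ne_zero hi)).1
  · intro i
    by_cases hi : (i : ℕ) = 0
    · simp [hi]
    · simpa [hi] using (chebT_monic_and_natDegree (Nat.pos_of_ne_zero hi)).2
  · intro i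
    by_cases hi : (i : ℕ) = 0
    · refine ⟨0, ?_⟩
      simp [hi, hR]
    · have hlt := i.2
      -- The partner is the mirror image about `c = (2k + 1)n + k`: the indices `c + i` and `c - i`
      -- sum to `chebP c * chebT i`.
      refine ⟨Pi.single ⟨k - i, by omega⟩ 1, ?_⟩
      have h := chebP_add_chebP_sub ((2 * k + 1) * n + k) i
      simp only [Pi.single_apply, apply_ite C, ite_mul, map_one, map_zero, one_mul, zero_mul,
        Finset.sum_ite_eq', Finset.mem_univ, if_true, hi, if_false]
      rw [← mul_assoc, ← hR, ← h]
      push_cast [hlt.le]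
      congr 2 <;> ring

theorem hankelDet_odd_half_period (k n : ℕ) :
    hankelDet (2 * k + 1) ((2 * k + 1) * n + k + 1) =
      (-1) ^ Nat.choose (k + 1) 2 * 4 ^ k * ((n : ℤ) + 1) ^ k := by
  obtain ⟨R, hR⟩ := chebP_dvd_chebS k (n + 1)
  have hR0 : R.eval 0 = (-1) ^ (n + k) * (n + 1) := by
    have h := congrArg (eval 0) hR
    have h1 := eval_zero_chebS ((2 * k + 1) * (n + 1))
    push_cast at h1 h
    rw [h1, eval_mul, eval_zero_chebP, pow_mul, Odd.neg_one_pow ⟨k, rfl⟩] at h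
    have h2 : ((-1) ^ k * (2 * k + 1) : ℤ) ≠ 0 := mul_ne_zero (by simp) (by positivity)
    apply mul_left_cancel₀ h2
    have h3 : ((-1) ^ k * (-1) ^ k : ℤ) = 1 := by rw [← mul_pow]; simp
    rw [← h]
    linear_combination -(2 * (k : ℤ) + 1) * (-1) ^ n * (n + 1) * h3
  -- Here the centre is `c = (2k + 1)(n + 1)`: `chebP (c + i) - chebP (c - 1 - i)` equals `chebS c *
  -- (X - 4) * chebW i`, and `X - 4` at `0` is the source of `4 ^ k`.
  rw [hankelDet_eq_of_dvd_sub_rev (A := chebP k) (G := R * (X - 4)) (ε := (-1) ^ (n + 1)) (d := k)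
    (e := k) (W := fun i => chebW (i : ℕ)) (chebP_monic k) (natDegree_chebP k)
    (oddBinomMoment_chebP k), eval_mul, hR0]
  · have h1 : (((-1) ^ (n + 1)) ^ k * ((-1) ^ (n + k) * (-1)) ^ k : ℤ) = (-1) ^ k := by
      rw [← mul_pow, ← pow_succ, ← pow_add, show n + 1 + (n + k + 1) = 2 * (n + 1) + k by ring,
        pow_add, pow_mul, neg_one_sq, one_pow, one_mul, ← pow_mul]
      exact neg_one_pow_congr (by simp [Nat.even_mul])
    rw [← two_mul, mul_assoc 2 k, pow_mul _ 2, neg_one_sq, one_pow, Nat.choose_succ_succ',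
      Nat.choose_one_right, pow_add _ k, ← h1]
    simp only [eval_sub, eval_X, eval_ofNat, zero_sub]
    rw [show ((-1) ^ (n + k) * (n + 1) * -4 : ℤ) = (-1) ^ (n + k) * (-1) * 4 * (n + 1) by ring,
      mul_pow _ ((n : ℤ) + 1), mul_pow _ (4 : ℤ)]
    ring
  · intro i hi
    have h := dvd_chebP_odd_rev k n i
    push_cast
    simpa only [add_assoc] using h
  · exact fun i => chebW_monic i
  · exact fun i => natDegree_chebW i
  · intro i
    have hlt := i.2
    refine ⟨Pi.single ⟨k - 1 - i, by omega⟩ (-1), ?_⟩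
    have h := chebP_sub_chebP_reflect ((2 * k + 1) * (n + 1 : ℕ)) i
    simp only [Pi.single_apply, apply_ite C, ite_mul, map_one, map_zero, map_neg, zero_mul,
      Finset.sum_ite_eq', Finset.mem_univ, if_true, neg_mul, one_mul]
    rw [← mul_assoc, ← mul_assoc, ← hR, ← h, ← sub_eq_add_neg, Nat.sub_sub]
    push_cast [show 1 + (i : ℕ) ≤ k by omega]
    congr 2 <;> ring

theorem hankelDet_even_period (k n : ℕ) :
    hankelDet (2 * k) (2 * k * n) = (-1) ^ (k * n) := by
  -- For `k = 0` the matrix is empty; the factor `X ^ (k - 1)` in `Q` requires `k ≥ 1`.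
  rcases k with _ | l
  · rw [show 2 * 0 * n = 0 by ring]
    simp [hankelDet]
  obtain ⟨hm, hd⟩ := chebT_monic_and_natDegree (show 1 ≤ l + 1 by omega)
  obtain ⟨R, hR⟩ := chebT_dvd_chebT (l + 1 : ℕ) n
  have hR0 : R.eval 0 = 1 := by
    have h := congrArg (eval 0) hR
    have h1 := eval_zero_chebT (2 * (l + 1) * n + (l + 1))
    have h3 := eval_zero_chebT (l + 1)
    push_cast at h1 h h3
    rw [h1, eval_mul, h3, pow_add, mul_assoc 2, pow_mul, neg_one_sq, one_pow] at h
    have h2 : ((-1) ^ (l + 1) * 2 : ℤ) ≠ 0 := mul_ne_zero (by simp) (by positivity)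
    apply mul_left_cancel₀ h2
    rw [← h]
    ring
  rw [hankelDet_eq_of_dvd_sub (G := R) (ε := (-1) ^ n) (d := l + 1) (e := l)
    (W := fun i => chebP (i : ℕ)) hm hd (oddBinomMoment_chebT l), hR0]
  · rw [mul_comm, ← pow_mul]
    have : Even ((l + 1 + l) * (2 * (l + 1) * n)) := by simp [Nat.even_mul]
    rw [this.neg_one_pow]
    simp [mul_comm]
  · intro i hi
    have h := chebT_dvd_chebP_add_period (l + 1 : ℕ) i n
    push_cast at h ⊢
    simpa using h
  · exact fun i => chebP_monic i
  · exact fun i => natDegree_chebP i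
  · intro i
    have hlt := i.2
    refine ⟨Pi.single ⟨l - i, by omega⟩ 1, ?_⟩
    have h := chebP_add_chebP_reflect (2 * (l + 1 : ℕ) * n + (l + 1 : ℕ)) i
    simp only [Pi.single_apply, apply_ite C, ite_mul, map_one, map_zero, one_mul, zero_mul,
      Finset.sum_ite_eq', Finset.mem_univ, if_true]
    rw [← mul_assoc, ← hR, ← h]
    push_cast [hlt.le]
    congr 2 <;> ring

theorem hankelDet_even_half_period (l n : ℕ) :
    hankelDet (2 * (l + 1)) (2 * (l + 1) * n + (l + 1)) =
      (-1) ^ ((l + 1) * n + Nat.choose (l + 1) 2) * (4 * ((l : ℤ) + 1)) ^ l * ((n : ℤ) + 1) ^ l := by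
  obtain ⟨hm, hd⟩ := chebT_monic_and_natDegree (show 1 ≤ l + 1 by omega)
  obtain ⟨R, hR⟩ := chebT_dvd_chebS (l + 1 : ℕ) (n + 1)
  have hR0 : R.eval 0 = (-1) ^ l * ((l + 1) * (n + 1)) := by
    have h := congrArg (eval 0) hR
    have h1 := eval_zero_chebS (2 * (l + 1) * (n + 1))
    have h3 := eval_zero_chebT (l + 1)
    push_cast at h1 h h3
    rw [h1, eval_mul, h3, mul_assoc 2, pow_mul, neg_one_sq, one_pow] at h
    have h2 : ((-1) ^ (l + 1) * 2 : ℤ) ≠ 0 := mul_ne_zero (by simp) (by positivity)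
    apply mul_left_cancel₀ h2
    have h3 : ((-1) ^ l * (-1) ^ l : ℤ) = 1 := by rw [← mul_pow]; simp
    rw [← h]
    linear_combination 2 * ((l : ℤ) + 1) * (n + 1) * h3
  rw [hankelDet_eq_of_dvd_sub_rev (G := R * (X - 4)) (ε := (-1) ^ (n + 1)) (d := l + 1) (e := l)
    (W := fun i => chebW (i : ℕ)) hm hd (oddBinomMoment_chebT l), eval_mul, hR0]
  · simp only [eval_sub, eval_X, eval_ofNat, zero_sub]
    rw [show ((-1) ^ l * ((l + 1) * (n + 1)) * -4 : ℤ) = (-1) ^ (l + 1) * (4 * (l + 1) * (n + 1)) by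
      ring, mul_pow, mul_pow _ ((n : ℤ) + 1), ← pow_mul, ← pow_mul]
    -- The signs come from Christoffel's formula, from `ε ^ d`, and from `G(0) ^ e`; the reversal
    -- sign is kept apart as `(l + 1).choose 2`.
    have h : ((-1) ^ ((l + 1 + l) * (2 * (l + 1) * n + (l + 1))) *
        ((-1) ^ ((n + 1) * (l + 1)) * (-1) ^ ((l + 1) * l)) : ℤ) = (-1) ^ ((l + 1) * n) := by
      rw [← pow_add, ← pow_add]
      exact neg_one_pow_congr (by simp [Nat.even_add, Nat.even_mul, -Nat.not_even_iff_odd]; tauto)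
    rw [pow_add _ ((l + 1) * n), ← h]
    ring
  · intro i hi
    have h := dvd_chebP_even_rev (l + 1) n i
    push_cast at h ⊢
    simpa only [add_assoc] using h
  · exact fun i => chebW_monic i
  · exact fun i => natDegree_chebW i
  · intro i
    have hlt := i.2
    refine ⟨Pi.single ⟨l - i, by omega⟩ (-1), ?_⟩
    have h := chebP_sub_chebP_reflect (2 * (l + 1 : ℕ) * (n + 1 : ℕ)) i
    simp only [Pi.single_apply, apply_ite C, ite_mul, map_one, map_zero, map_neg, zero_mul,
      Finset.sum_ite_eq', Finset.mem_univ, if_true, neg_mul, one_mul]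
    rw [← mul_assoc, ← mul_assoc, ← hR, ← h, ← sub_eq_add_neg]
    push_cast [hlt.le]
    congr 2 <;> ring

theorem mainTheorem1 :
    (∀ k n : ℕ,
      hankelDet (2 * k + 1) ((2 * k + 1) * n) = (2 * (n : ℤ) + 1) ^ k) ∧
    (∀ k n : ℕ,
      hankelDet (2 * k + 1) ((2 * k + 1) * n + k + 1) =
        (-1) ^ Nat.choose (k + 1) 2 * 4 ^ k * ((n : ℤ) + 1) ^ k) ∧
    (∀ k n : ℕ,
      hankelDet (2 * k) (2 * k * n) = (-1) ^ (k * n)) ∧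
    (∀ k n : ℕ, 1 ≤ k →
      hankelDet (2 * k) (2 * k * n + k) =
        (-1) ^ (k * n + Nat.choose k 2) * (4 * (k : ℤ)) ^ (k - 1) * ((n : ℤ) + 1) ^ (k - 1)) := by
  refine ⟨hankelDet_odd_period, hankelDet_odd_half_period, hankelDet_even_period, ?_⟩
  intro k n hk
  obtain ⟨l, rfl⟩ := Nat.exists_eq_add_of_le' hk
  simpa using hankelDet_even_half_period l n
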